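/- Let $G$ be a locally compact, second countable Hausdorff topological group acting properly (and continuously) on a Polish space $\mathcal X$, i.e. $(g,x)\mapsto(gx,x)$ is a proper map $G\times\mathcal X\to\mathcal X\times\mathcal X$, and acting measurably on a standard Borel space $\mathcal Y$ (i.e. $(g,y)\mapsto gy$ is jointly measurable). For $x\in\mathcal X$ let $G_x=\{g\in G: gx=x\}$ be the stabilizer, a compact subgroup of $G$, and let $\mathrm{Unif}(G_x)$ be its normalized Haar measure, viewed as a probability measure on $G$. A function $f:\mathcal X\to\mathcal Y$ is called *relaxed equivariant* if for all $x\in\mathcal X$ and $g\in G$ there is $h\in gG_x$ with $f(gx)=h\,f(x)$. For random variables $X,Y$ with values in $\mathcal X,\mathcal Y$ on a probability space $(\Omega,P)$, the conditional distribution $P(Y\mid X)$ is called *equivariant* if there is a regular version $x\mapsto P(Y\in\cdot\mid X=x)$ of it such that $P(Y\in\cdot\mid X=gx)=g_*\,P(Y\in\cdot\mid X=x)$ for all $g\in G$ and all $x\in\mathcal X$. Then, for all such $X$ and $Y$, $P(Y\mid X)$ is equivariant if and only if there are a measurable function $f:\mathcal X\times(0,1)\to\mathcal Y$ such that $f(\cdot,e)$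 is relaxed equivariant for every $e\in(0,1)$, and, on some extension of the probability space $(\Omega,P)$ (a probability space $(\Omega',P')$ with a measure-preserving map $\Omega'\to\Omega$, through which $X$ and $Y$ are regarded as random variables on $\Omega'$), a $G$-valued random variable $g_X$ and a random variable $\epsilon\sim\mathrm{Unif}(0,1)$ such that the conditional distribution of $g_X$ given $X=x$ is $\mathrm{Unif}(G_x)$ for almost every value $x$ of $X$, $\epsilon$ is independent of the pair $(X,g_X)$, and $$Y = g_X\, f(X,\epsilon)\quad\text{almost surely.}$$ -/

import Mathlib

open MeasureTheory ProbabilityTheory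
open scoped Pointwise

universe u

/-- Stabilizers of a proper action on a Hausdorff (indeed `T1`) space are compact. -/
theorem compactSpace_stabilizer_of_properSMul {G X : Type*} [Group G] [TopologicalSpace G]
    [TopologicalSpace X] [T1Space X] [MulAction G X] [ProperSMul G X] (x : X) :
    CompactSpace (MulAction.stabilizer G x) := by
  have h : IsCompact {g : G | (g • ({x} : Set X) ∩ {x}).Nonempty} :=
    ProperSMul.isCompact_setOfPred_inter_nonempty isCompact_singleton isCompact_singleton
  have e : {g : G | (g • ({x} : Set X) ∩ {x}).Nonempty} = (MulAction.stabilizer G x : Set G) := by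
    ext g
    simp [Set.smul_set_singleton, MulAction.mem_stabilizer_iff, eq_comm]
  rw [e] at h
  exact isCompact_iff_compactSpace.mp h

/-- `Unif(H)` for a compact subgroup `H` of `G`: the Haar measure of total mass `1` on `H`,
viewed as a measure on `G`. -/
noncomputable def unifSubgroup {G : Type*} [Group G] [TopologicalSpace G] [IsTopologicalGroup G]
    [MeasurableSpace G] [BorelSpace G] (H : Subgroup G) [CompactSpace H] : Measure G :=
  (Measure.haarMeasure (⊤ : TopologicalSpace.PositiveCompacts H)).map Subtype.val

/-- `Unif(G_x)`, the uniform distribution on the stabilizer of `x` under a proper action. -/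
noncomputable def unifStabilizer (G : Type*) {X : Type*} [Group G] [TopologicalSpace G]
    [IsTopologicalGroup G] [MeasurableSpace G] [BorelSpace G] [TopologicalSpace X] [T1Space X]
    [MulAction G X] [ProperSMul G X] (x : X) : Measure G :=
  haveI := compactSpace_stabilizer_of_properSMul (G := G) x
  unifSubgroup (MulAction.stabilizer G x)

/-- The conditional distribution of `Z` given `X = x` is `ν x`, for almost every value `x` of `X`. -/
def HasCondLaw {Ω 𝓧 𝓩 : Type*} [MeasurableSpace Ω] [MeasurableSpace 𝓧] [MeasurableSpace 𝓩]
    (Z : Ω → 𝓩) (X : Ω → 𝓧) (ν : 𝓧 → Measure 𝓩) (P : Measure Ω) : Prop :=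
  ∃ κ : Kernel 𝓧 𝓩, IsMarkovKernel κ ∧ HasCondDistrib Z X κ P ∧ ∀ᵐ x ∂(P.map X), κ x = ν x

/-- The conditional distribution `P(Y | X)` is equivariant: it has a version
`x ↦ P(Y | X = x)` with `P(Y | X = g x) = g · P(Y | X = x)` for all `g` and `x`, where `g` acts on
measures by push-forward. -/
def IsEquivariantCondDistrib (G : Type*) {Ω 𝓧 𝓨 : Type*} [MeasurableSpace Ω] [MeasurableSpace 𝓧]
    [MeasurableSpace 𝓨] [SMul G 𝓧] [SMul G 𝓨] (Y : Ω → 𝓨) (X : Ω → 𝓧) (P : Measure Ω) : Prop :=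
  ∃ κ : Kernel 𝓧 𝓨, IsMarkovKernel κ ∧ HasCondDistrib Y X κ P ∧
    ∀ (g : G) (x : 𝓧), κ (g • x) = (κ x).map (fun y => g • y)

/-- `f` is relaxed equivariant: for all `x` and `g`, `f (g x) = h f(x)` for some `h ∈ g G_x`. -/
def IsRelaxedEquivariant (G : Type*) {𝓧 𝓨 : Type*} [Group G] [MulAction G 𝓧] [MulAction G 𝓨]
    (f : 𝓧 → 𝓨) : Prop :=
  ∀ (x : 𝓧) (g : G), ∃ h ∈ g • (MulAction.stabilizer G x : Set G), f (g • x) = h • f x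

/-- The uniform distribution `Unif(0,1)` on the open unit interval (Lebesgue measure). -/
noncomputable def unifUnitInterval : Measure (Set.Ioo (0 : ℝ) 1) :=
  (volume : Measure ℝ).comap Subtype.val

/-! Everything is a statement about the kernel `noiseKernel f`, sending `x` to the law of `k • f (x,
ε)` with independent `k ∼ Unif(G_x)` and `ε ∼ Unif(0,1)`. If `f(·, e)` is relaxed equivariant, then
`f (g • x, e) = g • h₀ • f (x, e)` with `h₀ ∈ G_x`. Since `Unif(G_{gx})` is the conjugate of
`Unif(G_x)` by `g`, and right invariance absorbs `h₀`, the kernel is equivariant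
(`noiseKernel_smul`).

Conversely, let `κ` be equivariant. Choose measurably an orbit representative `γ x` and `τ x` with
`τ x • γ x = x`, write `κ` as the law of `φ x U` with `U` uniform, and put `f (x, e) = τ x • φ (γ x)
e`. For each `k ∈ G_x`, equivariance gives `k • f (x, ε)` the law `κ x`, so `noiseKernel f = κ`
(`exists_noiseKernel_eq`). An extra uniform variable then samples `(g_X, ε)` from its conditional
law given `(X, Y)`, turning equality of laws into an almost sure identity.

Two measurability facts carry the argument: `γ` and `τ` come from a selection theorem, and `x ↦
Unif(G_x)` is a limit of Haar averages over neighbourhoods shrinking to `G_x`. -/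

open Filter Topology in
/-- **Kuratowski–Ryll-Nardzewski selection theorem**: a weakly measurable multifunction with
nonempty closed values in a Polish space has a measurable selection. -/
theorem exists_measurable_selection {S E : Type*} [MeasurableSpace S] [TopologicalSpace E]
    [PolishSpace E] [MeasurableSpace E] [BorelSpace E] (F : S → Set E)
    (hne : ∀ s, (F s).Nonempty) (hcl : ∀ s, IsClosed (F s))
    (hm : ∀ U, IsOpen U → MeasurableSet {s | (F s ∩ U).Nonempty}) :
    ∃ f : S → E, Measurable f ∧ ∀ s, f s ∈ F s := by
  classical
  rcases isEmpty_or_nonempty S with hS | ⟨⟨s₀⟩⟩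
  · exact ⟨fun s => isEmptyElim s, measurable_of_empty _, fun s => isEmptyElim s⟩
  have : Nonempty E := (hne s₀).to_type
  let := TopologicalSpace.upgradeIsCompletelyMetrizable E
  let d : ℕ → E := TopologicalSpace.denseSeq E
  let r : ℕ → ℝ := fun k => (1 / 2) ^ k
  have hr : ∀ k, 0 < r k := fun k => by positivity
  have hd : ∀ (y : E) (k : ℕ), ∃ n, y ∈ Metric.ball (d n) (r k) := fun y k => by
    obtain ⟨n, hn⟩ := (TopologicalSpace.denseRange_denseSeq E).exists_dist_lt y (hr k)
    exact ⟨n, hn⟩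
  -- the least `n` such that the ball around `d n` meets the given open set inside `F s`
  have key : ∀ (U : Set E) (k : ℕ), IsOpen U → ∃ φ : S → ℕ, Measurable φ ∧
      ∀ s, (F s ∩ U).Nonempty → (F s ∩ (U ∩ Metric.ball (d (φ s)) (r k))).Nonempty := by
    intro U k hU
    let p : ℕ → S → Prop := fun n s =>
      (F s ∩ (U ∩ Metric.ball (d n) (r k))).Nonempty ∨ ¬ (F s ∩ U).Nonempty
    have hp : ∀ s, ∃ n, p n s := by
      intro s
      by_cases h : (F s ∩ U).Nonempty
      · obtain ⟨y, hyF, hyU⟩ := h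
        obtain ⟨n, hn⟩ := hd y k
        exact ⟨n, Or.inl ⟨y, hyF, hyU, hn⟩⟩
      · exact ⟨0, Or.inr h⟩
    refine ⟨fun s => Nat.find (hp s), measurable_find hp fun n => ?_, fun s hs => ?_⟩
    · exact (hm _ (hU.inter Metric.isOpen_ball)).union (hm _ hU).compl
    · exact (Nat.find_spec (hp s)).resolve_right (not_not.mpr hs)
  choose φ hφm hφ using key
  -- Each new ball meets `F s` inside the previous ball, so consecutive centres are at distance at
  -- most `r k + r (k + 1) ≤ 2 * r k` and form a Cauchy sequence.
  let a : ℕ → S → ℕ := fun k => Nat.rec (φ Set.univ 0 isOpen_univ)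
    (fun k ak s => φ (Metric.ball (d (ak s)) (r k)) (k + 1) Metric.isOpen_ball s) k
  have ha : ∀ k, Measurable (a k) := by
    intro k
    induction k with
    | zero => exact hφm _ _ _
    | succ k ih =>
      have : Measurable fun q : ℕ × S =>
          φ (Metric.ball (d q.1) (r k)) (k + 1) Metric.isOpen_ball q.2 :=
        measurable_from_prod_countable_right fun n =>
          hφm (Metric.ball (d n) (r k)) (k + 1) Metric.isOpen_ball
      exact this.comp (ih.prodMk measurable_id)
  have hane : ∀ k s, (F s ∩ Metric.ball (d (a k s)) (r k)).Nonempty := by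
    intro k s
    induction k with
    | zero =>
      have := hφ Set.univ 0 isOpen_univ s (by simpa using hne s)
      rwa [Set.univ_inter] at this
    | succ k ih =>
      obtain ⟨y, h1, h2⟩ := hφ (Metric.ball (d (a k s)) (r k)) (k + 1) Metric.isOpen_ball s ih
      exact ⟨y, h1, h2.2⟩
  have hdist : ∀ s k, dist (d (a k s)) (d (a (k + 1) s)) ≤ 2 * (1 / 2) ^ k := by
    intro s k
    obtain ⟨y, -, h1, h2⟩ :=
      hφ (Metric.ball (d (a k s)) (r k)) (k + 1) Metric.isOpen_ball s (hane k s)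
    have h2' : dist y (d (a (k + 1) s)) < r (k + 1) := h2
    have h1' : dist y (d (a k s)) < r k := h1
    have h3 := dist_triangle_left (d (a k s)) (d (a (k + 1) s)) y
    have h4 : r (k + 1) ≤ r k := pow_le_pow_of_le_one (by norm_num) (by norm_num) k.le_succ
    have h5 : r k = (1 / 2) ^ k := rfl
    linarith
  have hc : ∀ s, ∃ y, Tendsto (fun k => d (a k s)) atTop (𝓝 y) := fun s =>
    cauchySeq_tendsto_of_complete
      (cauchySeq_of_le_geometric (1 / 2) 2 (by norm_num) (hdist s))
  choose f hf using hc
  refine ⟨f, measurable_of_tendsto_metrizable (f := fun k s => d (a k s))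
    (fun k => (measurable_from_nat (f := d)).comp (ha k)) (tendsto_pi_nhds.mpr hf), fun s => ?_⟩
  choose y hyF hyB using fun k => hane k s
  refine (hcl s).mem_of_tendsto (f := y) (b := atTop) ?_ (Eventually.of_forall hyF)
  have h0 : Tendsto r atTop (𝓝 0) := tendsto_pow_atTop_nhds_zero_of_lt_one (by norm_num) (by norm_num)
  refine tendsto_iff_dist_tendsto_zero.mpr ?_
  refine squeeze_zero (g := fun k => r k + dist (d (a k s)) (f s)) (fun _ => dist_nonneg)
    (fun k => (dist_triangle _ (d (a k s)) _).trans ?_) ?_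
  · have : dist (y k) (d (a k s)) < r k := hyB k
    linarith
  · simpa using h0.add (tendsto_iff_dist_tendsto_zero.mp (hf s))

/-- A locally compact second countable Hausdorff group is Polish. -/
theorem polishSpace_of_locallyCompact_group (G : Type*) [Group G] [TopologicalSpace G]
    [IsTopologicalGroup G] [LocallyCompactSpace G] [SecondCountableTopology G] [T2Space G] :
    PolishSpace G := by
  let := IsTopologicalGroup.rightUniformSpace G
  have : IsRightUniformGroup G := ⟨rfl⟩
  have : (uniformity G).IsCountablyGenerated := by
    rw [uniformity_eq_comap_mul_inv_nhds_one]
    infer_instance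
  have : CompleteSpace G := IsRightUniformGroup.completeSpace_of_weaklyLocallyCompactSpace
  have : TopologicalSpace.IsCompletelyMetrizableSpace G := inferInstance
  infer_instance

/-- Orbit representatives of a proper action can be chosen measurably, together with group elements
moving the representative of the orbit of `x` to `x`. -/
theorem exists_measurable_orbit_representative (G : Type*) {𝓧 : Type*} [Group G]
    [TopologicalSpace G] [LocallyCompactSpace G] [PolishSpace G] [MeasurableSpace G] [BorelSpace G]
    [TopologicalSpace 𝓧] [PolishSpace 𝓧] [MeasurableSpace 𝓧] [BorelSpace 𝓧]
    [MulAction G 𝓧] [ProperSMul G 𝓧] :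
    ∃ (γ : 𝓧 → 𝓧) (τ : 𝓧 → G), Measurable γ ∧ Measurable τ ∧ (∀ (g : G) x, γ (g • x) = γ x) ∧
      ∀ x, τ x • γ x = x := by
  let := MulAction.orbitRel G 𝓧
  let mk : 𝓧 → Quotient (MulAction.orbitRel G 𝓧) := Quotient.mk'
  have hmkc : Continuous mk := continuous_quotient_mk'
  -- Properness makes the orbit space Hausdorff, so orbits are closed; the orbit map is open, so
  -- saturations of open sets are open.
  obtain ⟨σ, hσm, hσ⟩ := exists_measurable_selection (fun q => mk ⁻¹' {q})
    (fun q => Quotient.exists_rep q) (fun q => isClosed_singleton.preimage hmkc) (by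
      intro U hU
      have : {q | (mk ⁻¹' {q} ∩ U).Nonempty} = mk '' U := by
        ext q
        constructor
        · rintro ⟨x, h1, h2⟩
          exact ⟨x, h2, h1⟩
        · rintro ⟨x, h2, h1⟩
          exact ⟨x, h1, h2⟩
      rw [this, measurableSet_quotient]
      exact ((isOpenMap_quotient_mk'_mul (Γ := G) U hU).preimage hmkc).measurableSet)
  let γ : 𝓧 → 𝓧 := fun x => σ (mk x)
  have hγm : Measurable γ := hσm.comp measurable_quotient_mk'
  obtain ⟨τ, hτm, hτ⟩ := exists_measurable_selection (fun x => {g : G | g • γ x = x})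
    (fun x => by
      have h : mk (γ x) = mk x := hσ (mk x)
      have h' : x ∈ MulAction.orbit G (γ x) := MulAction.orbitRel_apply.mp (Quotient.exact h.symm)
      exact h')
    (fun x => isClosed_eq (by fun_prop) continuous_const) (by
      intro U hU
      have : SecondCountableTopology U := inferInstance
      have : LocallyCompactSpace U := hU.locallyCompactSpace
      -- `U` is σ-compact, and for compact `K n` the relation `∃ g ∈ K n, g • p.1 = p.2` is closed,
      -- being a projection along a compact factor.
      let K : ℕ → Set G := fun n => Subtype.val '' compactCovering U n
      have hK : ∀ n, IsCompact (K n) := fun n =>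
        (isCompact_compactCovering U n).image continuous_subtype_val
      have hUK : U = ⋃ n, K n := by
        rw [← Set.image_iUnion, iUnion_compactCovering, Set.image_univ, Subtype.range_coe]
      have : {x | ({g : G | g • γ x = x} ∩ U).Nonempty} =
          ⋃ n, (fun x => (γ x, x)) ⁻¹' {p : 𝓧 × 𝓧 | ∃ g ∈ K n, g • p.1 = p.2} := by
        ext x
        simp only [Set.mem_iUnion, Set.mem_preimage, Set.mem_ofPred_eq]
        constructor
        · rintro ⟨g, h1, h2⟩
          rw [hUK, Set.mem_iUnion] at h2
          obtain ⟨n, hn⟩ := h2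
          exact ⟨n, g, hn, h1⟩
        · rintro ⟨n, g, hn, h1⟩
          exact ⟨g, h1, by rw [hUK]; exact Set.mem_iUnion.mpr ⟨n, hn⟩⟩
      rw [this]
      refine MeasurableSet.iUnion fun n => ?_
      have hcl : IsClosed {p : 𝓧 × 𝓧 | ∃ g ∈ K n, g • p.1 = p.2} := by
        have := isCompact_iff_compactSpace.mp (hK n)
        have h2 : IsClosed {q : K n × (𝓧 × 𝓧) | (q.1 : G) • q.2.1 = q.2.2} :=
          isClosed_eq (by fun_prop) (by fun_prop)
        have := isClosedMap_snd_of_compactSpace (X := K n) (Y := 𝓧 × 𝓧) _ h2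
        convert this using 1
        ext p
        simp
      exact hcl.measurableSet.preimage (hγm.prodMk measurable_id))
  refine ⟨γ, τ, hγm, hτm, fun g x => ?_, hτ⟩
  exact congrArg σ (Quotient.sound (MulAction.orbitRel_apply.mpr ⟨g, rfl⟩))

/-! ### Uniform measures on stabilizers -/

section UnifStabilizer

open Filter Topology ENNReal

variable {G : Type*} [Group G] [TopologicalSpace G] [IsTopologicalGroup G]
  [MeasurableSpace G] [BorelSpace G]
  {𝓧 : Type*} [TopologicalSpace 𝓧] [T1Space 𝓧] [MulAction G 𝓧] [ProperSMul G 𝓧]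

theorem lintegral_unifStabilizer (x : 𝓧) {φ : G → ℝ≥0∞} (hφ : Measurable φ) :
    haveI := compactSpace_stabilizer_of_properSMul (G := G) x
    ∫⁻ g, φ g ∂unifStabilizer G x = ∫⁻ h : MulAction.stabilizer G x, φ h
      ∂(Measure.haarMeasure (⊤ : TopologicalSpace.PositiveCompacts (MulAction.stabilizer G x))) :=
  lintegral_map hφ measurable_subtype_coe

theorem isProbabilityMeasure_haarMeasure_top (H : Type*) [Group H] [TopologicalSpace H]
    [IsTopologicalGroup H] [CompactSpace H] [MeasurableSpace H] [BorelSpace H] :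
    IsProbabilityMeasure (Measure.haarMeasure (⊤ : TopologicalSpace.PositiveCompacts H)) :=
  ⟨by simpa using Measure.haarMeasure_self (K₀ := (⊤ : TopologicalSpace.PositiveCompacts H))⟩

/-- Compact groups are unimodular. -/
theorem isMulRightInvariant_haarMeasure_top (H : Type*) [Group H] [TopologicalSpace H]
    [IsTopologicalGroup H] [CompactSpace H] [MeasurableSpace H] [BorelSpace H] :
    (Measure.haarMeasure (⊤ : TopologicalSpace.PositiveCompacts H)).IsMulRightInvariant := by
  have := isProbabilityMeasure_haarMeasure_top H
  refine ⟨fun h => ?_⟩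
  have := Measure.isProbabilityMeasure_map
    (μ := Measure.haarMeasure (⊤ : TopologicalSpace.PositiveCompacts H))
    (measurable_mul_const h).aemeasurable
  exact Measure.isHaarMeasure_eq_of_isProbabilityMeasure _ _

instance isProbabilityMeasure_unifStabilizer (x : 𝓧) :
    IsProbabilityMeasure (unifStabilizer G x) := by
  have := compactSpace_stabilizer_of_properSMul (G := G) x
  have := isProbabilityMeasure_haarMeasure_top (MulAction.stabilizer G x)
  exact Measure.isProbabilityMeasure_map measurable_subtype_coe.aemeasurable

theorem ae_unifStabilizer_mem [T2Space G] (x : 𝓧) : ∀ᵐ g ∂unifStabilizer G x, g • x = x := by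
  have : T2Space 𝓧 := t2Space_of_properSMul_of_t1Group (G := G)
  have := compactSpace_stabilizer_of_properSMul (G := G) x
  have hms : MeasurableSet {g : G | g • x = x} :=
    (isClosed_eq (by fun_prop) continuous_const).measurableSet
  refine (ae_map_iff measurable_subtype_coe.aemeasurable hms).mpr (Eventually.of_forall ?_)
  exact fun h => h.2

/-- `Unif(G_x)` is invariant under right translation by elements of `G_x`. -/
theorem map_mul_right_unifStabilizer {x : 𝓧} {h : G} (hh : h ∈ MulAction.stabilizer G x) :
    (unifStabilizer G x).map (· * h) = unifStabilizer G x := by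
  have := compactSpace_stabilizer_of_properSMul (G := G) x
  have e : (Measure.haarMeasure (⊤ : TopologicalSpace.PositiveCompacts
      (MulAction.stabilizer G x))).map (· * ⟨h, hh⟩) = Measure.haarMeasure ⊤ :=
    (isMulRightInvariant_haarMeasure_top _).map_mul_right_eq_self _
  change Measure.map _ (Measure.map _ _) = Measure.map _ _
  conv_rhs => rw [← e]
  rw [Measure.map_map (by fun_prop) (by fun_prop), Measure.map_map (by fun_prop) (by fun_prop)]
  rfl

/-- Conjugation by `g` is a continuous surjective homomorphism from `G_x` to `G_{gx}`, so it carries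
normalized Haar measure to normalized Haar measure. -/
theorem unifStabilizer_smul (g : G) (x : 𝓧) :
    unifStabilizer G (g • x) = (unifStabilizer G x).map (fun h => g * h * g⁻¹) := by
  have := compactSpace_stabilizer_of_properSMul (G := G) x
  have := compactSpace_stabilizer_of_properSMul (G := G) (g • x)
  have hmem : ∀ h : MulAction.stabilizer G x, g * h * g⁻¹ ∈ MulAction.stabilizer G (g • x) := by
    rintro ⟨h, hh⟩
    simp only [MulAction.mem_stabilizer_iff] at hh ⊢
    rw [mul_smul, mul_smul, inv_smul_smul, hh]
  let c : MulAction.stabilizer G x →* MulAction.stabilizer G (g • x) :=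
    { toFun := fun h => ⟨g * h * g⁻¹, hmem h⟩
      map_one' := by ext; simp
      map_mul' := fun a b => by ext; simp [mul_assoc] }
  have hc : Continuous c := by
    refine Continuous.subtype_mk ?_ _
    fun_prop
  have hs : Function.Surjective c := by
    rintro ⟨k, hk⟩
    refine ⟨⟨g⁻¹ * k * g, ?_⟩, ?_⟩
    · simp only [MulAction.mem_stabilizer_iff] at hk ⊢
      rw [mul_smul, mul_smul, hk, inv_smul_smul]
    · ext
      simp [c, mul_assoc]
  have := isProbabilityMeasure_haarMeasure_top (MulAction.stabilizer G x)
  have := isProbabilityMeasure_haarMeasure_top (MulAction.stabilizer G (g • x))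
  have e : (Measure.haarMeasure (⊤ : TopologicalSpace.PositiveCompacts
      (MulAction.stabilizer G x))).map c = Measure.haarMeasure ⊤ :=
    (MonoidHom.measurePreserving hc hs (by simp)).map_eq
  change Measure.map _ _ = Measure.map _ (Measure.map _ _)
  rw [← e, Measure.map_map (by fun_prop) hc.measurable,
    Measure.map_map (by fun_prop) (by fun_prop)]
  rfl

/-- The points moving `x` by less than `r n → 0` concentrate around the stabilizer of `x`. -/
theorem eventually_forall_dist_inv_smul_lt {G : Type*} [Group G] [TopologicalSpace G]
    [IsTopologicalGroup G] {𝓧 : Type*} [MetricSpace 𝓧] [MulAction G 𝓧] [ProperSMul G 𝓧]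
    (x : 𝓧) {W : Set G} (hW : ∀ g ∈ MulAction.stabilizer G x, W ∈ 𝓝 g)
    {r : ℕ → ℝ} (hr : Tendsto r atTop (𝓝 0)) :
    ∀ᶠ n in atTop, ∀ g : G, dist (g⁻¹ • x) x < r n → g ∈ W := by
  -- By properness, the translates `g⁻¹ • x` with `g` outside `interior W` form a closed set; it
  -- misses `x`, hence a ball around `x`.
  have hcl : IsClosed (((interior W)ᶜ)⁻¹ • ({x} : Set 𝓧)) :=
    (isOpen_interior.isClosed_compl.inv).smul_right_of_isCompact isCompact_singleton
  have hx : x ∉ ((interior W)ᶜ)⁻¹ • ({x} : Set 𝓧) := by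
    rw [Set.smul_singleton]
    rintro ⟨g, hg, hgx⟩
    refine hg (mem_interior_iff_mem_nhds.mpr (hW _ ?_))
    exact inv_mem (s := MulAction.stabilizer G x) hgx
  obtain ⟨δ, hδ, hball⟩ := Metric.isOpen_iff.mp hcl.isOpen_compl x hx
  filter_upwards [hr.eventually_lt_const hδ] with n hn g hg
  by_contra hgW
  refine hball (Metric.mem_ball.mpr (hg.trans hn)) ?_
  rw [Set.smul_singleton]
  refine ⟨g⁻¹, ?_, rfl⟩
  simpa using fun h => hgW (interior_subset h)

/-- The sets `A n` are invariant under left translation by `G_x`, so over them `φ` may be replaced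
by its average `ψ` over `G_x`. This `ψ` is continuous and constant on `G_x`, with value the limit,
and `A n` shrinks to `G_x`. The averages on the left are visibly measurable in `x`. -/
theorem tendsto_setLIntegral_div_unifStabilizer {G : Type*} [Group G] [TopologicalSpace G]
    [IsTopologicalGroup G] [LocallyCompactSpace G] [SecondCountableTopology G] [T2Space G]
    [MeasurableSpace G] [BorelSpace G] {𝓧 : Type*} [MetricSpace 𝓧] [MulAction G 𝓧]
    [ProperSMul G 𝓧] (x : 𝓧) (φ : BoundedContinuousFunction G NNReal)
    {r : ℕ → ℝ} (hr0 : ∀ n, 0 < r n) (hr : Tendsto r atTop (𝓝 0)) :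
    Tendsto (fun n => (∫⁻ g in {g : G | dist (g⁻¹ • x) x < r n}, φ g ∂Measure.haar) /
      Measure.haar {g : G | dist (g⁻¹ • x) x < r n}) atTop
      (𝓝 (∫⁻ g, φ g ∂unifStabilizer G x)) := by
  have hK := compactSpace_stabilizer_of_properSMul (G := G) x
  set H := MulAction.stabilizer G x
  set ν : Measure H := Measure.haarMeasure (⊤ : TopologicalSpace.PositiveCompacts H)
  have : IsProbabilityMeasure ν := isProbabilityMeasure_haarMeasure_top H
  have : ν.IsMulRightInvariant := isMulRightInvariant_haarMeasure_top H
  set A : ℕ → Set G := fun n => {g : G | dist (g⁻¹ • x) x < r n}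
  have hφm : Measurable fun g => (φ g : ℝ≥0∞) := by fun_prop
  have hAo : ∀ n, IsOpen (A n) := fun n => isOpen_lt (by fun_prop) continuous_const
  have hA0 : ∀ n, Measure.haar (A n) ≠ 0 := fun n =>
    ((hAo n).measure_pos _ ⟨1, by simpa [A] using hr0 n⟩).ne'
  have hAH : ∀ n (h : H) (g : G), (h : G) * g ∈ A n ↔ g ∈ A n := by
    rintro n ⟨h, hh⟩ g
    have : h⁻¹ • x = x := inv_mem (s := H) hh
    simp [A, mul_smul, this]
  let ψ : G → ℝ≥0∞ := fun g => ∫⁻ h : H, φ (h * g) ∂ν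
  have hψ1 : ∀ h ∈ H, ψ h = ∫⁻ g, φ g ∂unifStabilizer G x := by
    intro h hh
    rw [lintegral_unifStabilizer x hφm]
    exact lintegral_mul_right_eq_self (μ := ν) (fun k : H => (φ k : ℝ≥0∞)) ⟨h, hh⟩
  have hψc : Continuous ψ := by
    refine continuous_iff_continuousAt.mpr fun g => ?_
    refine tendsto_lintegral_filter_of_dominated_convergence (fun _ => (nndist φ 0 : ℝ≥0∞))
      (Eventually.of_forall fun g' => by fun_prop)
      (Eventually.of_forall fun g' => Eventually.of_forall fun h => ?_) (by simp)
      (Eventually.of_forall fun h => ?_)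
    · exact_mod_cast BoundedContinuousFunction.NNReal.upper_bound φ (h * g')
    · have : Continuous fun g' => (φ (h * g') : ℝ≥0∞) := by fun_prop
      exact this.tendsto g
  have hAψ : ∀ n, ∫⁻ g in A n, φ g ∂Measure.haar = ∫⁻ g in A n, ψ g ∂Measure.haar := by
    intro n
    have h1 : ∀ h : H, ∫⁻ g in A n, φ (h * g) ∂Measure.haar = ∫⁻ g in A n, φ g ∂Measure.haar := by
      intro h
      rw [← lintegral_indicator (hAo n).measurableSet, ← lintegral_indicator (hAo n).measurableSet,
        ← lintegral_mul_left_eq_self (Set.indicator (A n) fun g => (φ g : ℝ≥0∞)) (h : G)]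
      congr 1 with g
      by_cases hg : g ∈ A n
      · rw [Set.indicator_of_mem hg, Set.indicator_of_mem ((hAH n h g).mpr hg)]
      · rw [Set.indicator_of_notMem hg, Set.indicator_of_notMem (mt (hAH n h g).mp hg)]
    rw [lintegral_lintegral_swap (by fun_prop)]
    simp only [h1, lintegral_const, measure_univ, mul_one]
  have hU : ∀ V ∈ 𝓝 (∫⁻ g, φ g ∂unifStabilizer G x), ∀ᶠ n in atTop, ∀ g ∈ A n, ψ g ∈ V :=
    fun V hV => eventually_forall_dist_inv_smul_lt x (W := ψ ⁻¹' V)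
      (fun g hg => hψc.continuousAt.preimage_mem_nhds (by rwa [hψ1 g hg])) hr
  -- Eventually `A n` lies in a compact neighbourhood of `G_x`.
  have hfin : ∀ᶠ n in atTop, Measure.haar (A n) ≠ ∞ := by
    obtain ⟨K, hKc, hHK⟩ := exists_compact_superset
      (isCompact_iff_compactSpace.mpr hK : IsCompact (H : Set G))
    filter_upwards [eventually_forall_dist_inv_smul_lt x (W := K)
      (fun g hg => mem_interior_iff_mem_nhds.mp (hHK hg)) hr] with n hn
    exact ((measure_mono hn).trans_lt hKc.measure_lt_top).ne
  refine Tendsto.congr (fun n => by rw [← hAψ n]) (f₁ := fun n =>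
    (∫⁻ g in A n, ψ g ∂Measure.haar) / Measure.haar (A n)) ?_
  refine tendsto_order.mpr ⟨fun a ha => ?_, fun b hb => ?_⟩
  · obtain ⟨a', h1, h2⟩ := exists_between ha
    filter_upwards [hU _ (Ioi_mem_nhds h2), hfin] with n hn hf
    refine h1.trans_le ?_
    rw [ENNReal.le_div_iff_mul_le (Or.inl (hA0 n)) (Or.inl hf), ← setLIntegral_const]
    exact setLIntegral_mono' (hAo n).measurableSet fun g hg => (hn g hg).le
  · obtain ⟨b', h1, h2⟩ := exists_between hb
    filter_upwards [hU _ (Iio_mem_nhds h1), hfin] with n hn hf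
    refine lt_of_le_of_lt ?_ h2
    rw [ENNReal.div_le_iff_le_mul (Or.inl (hA0 n)) (Or.inl hf), ← setLIntegral_const]
    exact setLIntegral_mono' (hAo n).measurableSet fun g hg => (hn g hg).le

/-- The uniform distributions on the stabilizers of a proper action form a kernel. -/
theorem measurable_unifStabilizer (G : Type*) [Group G] [TopologicalSpace G]
    [IsTopologicalGroup G] [LocallyCompactSpace G] [SecondCountableTopology G] [T2Space G]
    [MeasurableSpace G] [BorelSpace G] {𝓧 : Type*} [TopologicalSpace 𝓧]
    [TopologicalSpace.MetrizableSpace 𝓧] [SecondCountableTopology 𝓧] [MeasurableSpace 𝓧]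
    [BorelSpace 𝓧] [MulAction G 𝓧] [ProperSMul G 𝓧] :
    Measurable (unifStabilizer G : 𝓧 → Measure G) := by
  let := TopologicalSpace.metrizableSpaceMetric 𝓧
  have : PolishSpace G := polishSpace_of_locallyCompact_group G
  let := TopologicalSpace.metrizableSpaceMetric G
  -- Closed sets suffice, and their indicators are limits of bounded continuous functions.
  refine Measurable.measure_of_isPiSystem_of_isProbabilityMeasure
    (BorelSpace.measurable_eq.trans borel_eq_generateFrom_isClosed) isPiSystem_isClosed ?_
  intro F hF
  have hF' : IsClosed F := hF
  refine measurable_of_tendsto_metrizable (f := fun n x => ∫⁻ g, hF'.apprSeq n g ∂unifStabilizer G x)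
    (fun n => ?_) (tendsto_pi_nhds.mpr fun x =>
      HasOuterApproxClosed.tendsto_lintegral_apprSeq hF' (unifStabilizer G x))
  have hr : Tendsto (fun n : ℕ => 1 / ((n : ℝ) + 1)) atTop (𝓝 0) :=
    tendsto_one_div_add_atTop_nhds_zero_nat
  refine measurable_of_tendsto_metrizable (fun m => ?_) (tendsto_pi_nhds.mpr fun x =>
    tendsto_setLIntegral_div_unifStabilizer x (hF'.apprSeq n) (fun m => by positivity) hr)
  have hS : MeasurableSet {p : 𝓧 × G | dist (p.2⁻¹ • p.1) p.1 < 1 / ((m : ℝ) + 1)} :=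
    (isOpen_lt (by fun_prop) continuous_const).measurableSet
  refine Measurable.div ?_ (measurable_measure_prodMk_left hS)
  have hm : Measurable fun p : 𝓧 × G => Set.indicator
      {p : 𝓧 × G | dist (p.2⁻¹ • p.1) p.1 < 1 / ((m : ℝ) + 1)}
      (fun p => (hF'.apprSeq n p.2 : ℝ≥0∞)) p :=
    Measurable.indicator (by fun_prop) hS
  convert hm.lintegral_prod_right' (ν := Measure.haar) using 2 with x
  rw [← lintegral_indicator]
  · rfl
  · exact (isOpen_lt (by fun_prop) continuous_const).measurableSet

end UnifStabilizer

/-! ### Uniform noise and realization of kernels -/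

open scoped unitInterval

/-- The endpoints are null. This transports kernel representations over `[0,1]` to noise in `(0,1)`.
-/
theorem measurePreserving_inclusion_unifUnitInterval :
    MeasurePreserving (Set.inclusion (Set.Ioo_subset_Icc_self : Set.Ioo (0 : ℝ) 1 ⊆ I))
      unifUnitInterval volume := by
  have hm : Measurable (Set.inclusion (Set.Ioo_subset_Icc_self : Set.Ioo (0 : ℝ) 1 ⊆ I)) :=
    measurable_inclusion _
  have he : MeasurableEmbedding (Subtype.val : I → ℝ) := .subtype_coe measurableSet_Icc
  refine ⟨hm, ?_⟩
  rw [← he.comap_map (Measure.map _ _), Measure.map_map measurable_subtype_coe hm,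
    ← he.comap_map volume, unitInterval.measurePreserving_coe.map_eq,
    show Subtype.val ∘ Set.inclusion (Set.Ioo_subset_Icc_self : Set.Ioo (0 : ℝ) 1 ⊆ I) =
      Subtype.val from rfl, unifUnitInterval, map_comap_subtype_coe measurableSet_Ioo,
    Measure.restrict_congr_set Ioo_ae_eq_Icc]

instance isProbabilityMeasure_unifUnitInterval : IsProbabilityMeasure unifUnitInterval :=
  ⟨by simpa using measurePreserving_inclusion_unifUnitInterval.measure_preimage
        MeasurableSet.univ.nullMeasurableSet⟩

section Kernels

variable {𝓧 𝓨 𝓩 : Type*} [MeasurableSpace 𝓧] [MeasurableSpace 𝓨] [MeasurableSpace 𝓩]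

theorem compProd_eq_map_compProd {μ : Measure 𝓧} [SFinite μ] {κ : Kernel 𝓧 𝓨} [IsSFiniteKernel κ]
    {η : Kernel 𝓧 𝓩} [IsSFiniteKernel η] {T : 𝓧 × 𝓩 → 𝓨} (hT : Measurable T)
    (h : ∀ x, κ x = (η x).map fun z => T (x, z)) :
    μ ⊗ₘ κ = (μ ⊗ₘ η).map fun q => (q.1, T q) := by
  ext s hs
  rw [Measure.compProd_apply hs, Measure.map_apply (by fun_prop) hs,
    Measure.compProd_apply (hs.preimage (by fun_prop))]
  refine lintegral_congr fun x => ?_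
  rw [h, Measure.map_apply (by fun_prop) (hs.preimage (by fun_prop))]
  rfl

theorem map_prodAssoc_compProd_prod {μ : Measure 𝓧} [SFinite μ] {κ : Kernel 𝓧 𝓨}
    [IsSFiniteKernel κ] (ν : Measure 𝓩) [SFinite ν] :
    ((μ ⊗ₘ κ).prod ν).map MeasurableEquiv.prodAssoc = μ ⊗ₘ (κ ×ₖ Kernel.const 𝓧 ν) := by
  ext s hs
  have hs' : MeasurableSet (MeasurableEquiv.prodAssoc ⁻¹' s : Set ((𝓧 × 𝓨) × 𝓩)) :=
    hs.preimage MeasurableEquiv.prodAssoc.measurable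
  rw [Measure.map_apply MeasurableEquiv.prodAssoc.measurable hs, Measure.prod_apply hs',
    Measure.lintegral_compProd (measurable_measure_prodMk_left hs'), Measure.compProd_apply hs]
  refine lintegral_congr fun x => ?_
  rw [Kernel.prod_apply, Kernel.const_apply, Measure.prod_apply (hs.preimage (by fun_prop))]
  rfl

theorem map_prod_eq_map_compProd {Ω U : Type*} [MeasurableSpace Ω] [MeasurableSpace U]
    {P : Measure Ω} [SFinite P] {ν : Measure U} [SFinite ν] {κ : Kernel 𝓧 𝓨} [IsSFiniteKernel κ]
    {Z : Ω → 𝓧} (hZ : Measurable Z) {ψ : 𝓧 → U → 𝓨} (hψ : Measurable (Function.uncurry ψ))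
    (h : ∀ x, ν.map (ψ x) = κ x) :
    (P.prod ν).map (fun p => (Z p.1, ψ (Z p.1) p.2)) = P.map Z ⊗ₘ κ := by
  have hm : Measurable fun p : Ω × U => (Z p.1, ψ (Z p.1) p.2) :=
    (by fun_prop : Measurable fun p : Ω × U => Z p.1).prodMk
      (hψ.comp ((by fun_prop : Measurable fun p : Ω × U => (Z p.1, p.2))))
  ext s hs
  rw [Measure.map_apply hm hs, Measure.prod_apply (hs.preimage hm), Measure.compProd_apply hs,
    lintegral_map (Kernel.measurable_kernel_prodMk_left hs) hZ]
  refine lintegral_congr fun ω => ?_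
  rw [← h, Measure.map_apply (f := ψ (Z ω)) (hψ.comp measurable_prodMk_left) (hs.preimage (by fun_prop))]
  rfl

end Kernels

/-! ### Equivariant kernels as noise kernels -/

section Proper

variable {G : Type*} [Group G] [TopologicalSpace G] [IsTopologicalGroup G] [LocallyCompactSpace G]
  [SecondCountableTopology G] [T2Space G] [MeasurableSpace G] [BorelSpace G]
  {𝓧 : Type*} [TopologicalSpace 𝓧] [PolishSpace 𝓧] [MeasurableSpace 𝓧] [BorelSpace 𝓧]
  [MulAction G 𝓧] [ProperSMul G 𝓧]
  {𝓨 : Type*} [MeasurableSpace 𝓨] [MulAction G 𝓨] [MeasurableSMul₂ G 𝓨]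

variable (G 𝓧) in
/-- The kernel `x ↦ Unif(G_x)`. -/
noncomputable def unifStabilizerKernel : Kernel 𝓧 G :=
  ⟨unifStabilizer G, measurable_unifStabilizer G⟩

instance : IsMarkovKernel (unifStabilizerKernel G 𝓧) :=
  ⟨fun x => isProbabilityMeasure_unifStabilizer x⟩

variable (G) in
/-- The law of `(X, g, ε)`, where `X ∼ μ`, `g ∼ Unif(G_X)` given `X`, and `ε ∼ Unif(0,1)` is
independent of `(X, g)`. -/
noncomputable def noiseLaw (μ : Measure 𝓧) : Measure ((𝓧 × G) × Set.Ioo (0 : ℝ) 1) :=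
  (μ ⊗ₘ unifStabilizerKernel G 𝓧).prod unifUnitInterval

instance (μ : Measure 𝓧) [IsProbabilityMeasure μ] : IsProbabilityMeasure (noiseLaw G μ) := by
  unfold noiseLaw
  infer_instance

/-- The kernel `x ↦ law of g f(x, ε)` with `g ∼ Unif(G_x)` and `ε ∼ Unif(0,1)` independent. -/
noncomputable def noiseKernel (f : 𝓧 × Set.Ioo (0 : ℝ) 1 → 𝓨) : Kernel 𝓧 𝓨 :=
  (Kernel.id ×ₖ (unifStabilizerKernel G 𝓧 ×ₖ Kernel.const 𝓧 unifUnitInterval)).map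
    fun q : 𝓧 × G × Set.Ioo (0 : ℝ) 1 => q.2.1 • f (q.1, q.2.2)

variable {f : 𝓧 × Set.Ioo (0 : ℝ) 1 → 𝓨}

theorem noiseKernel_apply (hf : Measurable f) (x : 𝓧) :
    noiseKernel (G := G) f x = ((unifStabilizerKernel G 𝓧 ×ₖ Kernel.const 𝓧 unifUnitInterval) x).map
      fun p : G × Set.Ioo (0 : ℝ) 1 => p.1 • f (x, p.2) := by
  rw [noiseKernel, Kernel.map_apply _ (by fun_prop), Kernel.prod_apply, Kernel.id_apply,
    Measure.dirac_prod, Measure.map_map (by fun_prop) (by fun_prop)]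
  rfl

theorem isMarkovKernel_noiseKernel (hf : Measurable f) :
    IsMarkovKernel (noiseKernel (G := G) f) :=
  Kernel.IsMarkovKernel.map _ (by fun_prop)

theorem map_noiseLaw (hf : Measurable f) (μ : Measure 𝓧) [SFinite μ] :
    (noiseLaw G μ).map (fun q => (q.1.1, q.1.2 • f (q.1.1, q.2))) =
      μ ⊗ₘ noiseKernel (G := G) f := by
  have := isMarkovKernel_noiseKernel (G := G) hf
  rw [compProd_eq_map_compProd (T := fun q : 𝓧 × G × Set.Ioo (0 : ℝ) 1 => q.2.1 • f (q.1, q.2.2))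
    (by fun_prop) (noiseKernel_apply hf), ← map_prodAssoc_compProd_prod,
    Measure.map_map (by fun_prop) (by fun_prop)]
  rfl

/-- If `f(·, e)` is relaxed equivariant for all `e`, then `noiseKernel f` is equivariant. -/
theorem noiseKernel_smul (hf : Measurable f)
    (hre : ∀ e, IsRelaxedEquivariant G fun x => f (x, e)) (g : G) (x : 𝓧) :
    noiseKernel (G := G) f (g • x) = (noiseKernel (G := G) f x).map fun y => g • y := by
  rw [noiseKernel_apply hf, noiseKernel_apply hf, Measure.map_map (by fun_prop) (by fun_prop)]
  ext s hs
  rw [Measure.map_apply (by fun_prop) hs, Measure.map_apply (by fun_prop) hs, Kernel.prod_apply,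
    Kernel.prod_apply, Kernel.const_apply, Kernel.const_apply,
    Measure.prod_apply_symm (hs.preimage (by fun_prop)),
    Measure.prod_apply_symm (hs.preimage (by fun_prop))]
  refine lintegral_congr fun e => ?_
  obtain ⟨h, ⟨h₀, hh₀, rfl⟩, hfe⟩ := hre e x g
  change unifStabilizer G (g • x) {k | k • f (g • x, e) ∈ s} =
    unifStabilizer G x {k | g • k • f (x, e) ∈ s}
  have hm : ∀ y : 𝓨, MeasurableSet {k : G | k • y ∈ s} := fun y =>
    hs.preimage (f := fun k : G => k • y) (by fun_prop)
  have hm' : ∀ y : 𝓨, MeasurableSet {k : G | g • k • y ∈ s} := fun y =>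
    hs.preimage (f := fun k : G => g • k • y) (by fun_prop)
  rw [unifStabilizer_smul, Measure.map_apply (by fun_prop) (hm _)]
  -- Right invariance inserts the factor `h₀` that relaxed equivariance produces on the other side.
  conv_rhs => rw [← map_mul_right_unifStabilizer hh₀, Measure.map_apply (by fun_prop) (hm' _)]
  congr 1
  ext k
  have hfe' : f (g • x, e) = g • h₀ • f (x, e) := by simpa [mul_smul] using hfe
  simp [hfe', mul_smul]

/-- Every equivariant Markov kernel is the noise kernel of a function that is relaxed equivariant
for every value of the noise. -/
theorem exists_noiseKernel_eq [StandardBorelSpace 𝓨] [Nonempty 𝓨] (κ : Kernel 𝓧 𝓨)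
    [IsMarkovKernel κ] (hκ : ∀ (g : G) (x : 𝓧), κ (g • x) = (κ x).map fun y => g • y) :
    ∃ f : 𝓧 × Set.Ioo (0 : ℝ) 1 → 𝓨, Measurable f ∧
      (∀ e, IsRelaxedEquivariant G fun x => f (x, e)) ∧ noiseKernel (G := G) f = κ := by
  have : PolishSpace G := polishSpace_of_locallyCompact_group G
  obtain ⟨γ, τ, hγ, hτ, hγG, hτγ⟩ := exists_measurable_orbit_representative G (𝓧 := 𝓧)
  obtain ⟨φ, hφ, hφκ⟩ := κ.exists_measurable_map_eq_unitInterval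
  let c := Set.inclusion (Set.Ioo_subset_Icc_self : Set.Ioo (0 : ℝ) 1 ⊆ I)
  have hc : MeasurePreserving c unifUnitInterval volume :=
    measurePreserving_inclusion_unifUnitInterval
  have hcm : Measurable c := hc.measurable
  let f : 𝓧 × Set.Ioo (0 : ℝ) 1 → 𝓨 := fun p => τ p.1 • Function.uncurry φ (γ p.1, c p.2)
  have hf : Measurable f := by fun_prop
  -- The element `τ (g • x) * (τ x)⁻¹` moves `x` to `γ x` and then to `g • x`, so it lies in `g
  -- G_x`.
  refine ⟨f, hf, fun e x g => ⟨τ (g • x) * (τ x)⁻¹, ?_, ?_⟩, ?_⟩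
  · refine ⟨g⁻¹ * (τ (g • x) * (τ x)⁻¹), ?_, by simp⟩
    have h1 : (τ x)⁻¹ • x = γ x := inv_smul_eq_iff.mpr (hτγ x).symm
    have h2 : τ (g • x) • γ x = g • x := by simpa [hγG] using hτγ (g • x)
    simp [MulAction.mem_stabilizer_iff, mul_smul, h1, h2]
  · simp [f, hγG, mul_smul]
  · ext x s hs
    rw [noiseKernel_apply hf, Measure.map_apply (by fun_prop) hs, Kernel.prod_apply,
      Kernel.const_apply, Measure.prod_apply (hs.preimage (by fun_prop))]
    -- The law over the noise is already `κ x` for each fixed `k ∈ G_x`, so averaging over `k`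
    -- changes nothing.
    have key : ∀ᵐ k ∂unifStabilizer G x, unifUnitInterval {e | k • f (x, e) ∈ s} = κ x s := by
      filter_upwards [ae_unifStabilizer_mem (G := G) x] with k hk
      have hx : κ x = (κ (γ x)).map fun y => (k * τ x) • y := by
        rw [← hκ, mul_smul, hτγ, hk]
      have hφx : Measurable (φ (γ x)) := hφ.comp measurable_prodMk_left
      rw [hx, ← hφκ, ← hc.map_eq, Measure.map_map hφx hcm,
        Measure.map_map (by fun_prop) (hφx.comp hcm),
        Measure.map_apply (by fun_prop) hs]
      congr 1
      ext e
      simp [f, mul_smul]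
    change ∫⁻ k, unifUnitInterval {e | k • f (x, e) ∈ s} ∂unifStabilizer G x = κ x s
    rw [lintegral_congr_ae key, lintegral_const, measure_univ, mul_one]

end Proper

/-! ### The noise conditions as one joint law -/

section Noise

variable {G : Type*} [Group G] [TopologicalSpace G] [IsTopologicalGroup G] [LocallyCompactSpace G]
  [SecondCountableTopology G] [T2Space G] [MeasurableSpace G] [BorelSpace G]
  {𝓧 : Type*} [TopologicalSpace 𝓧] [PolishSpace 𝓧] [MeasurableSpace 𝓧] [BorelSpace 𝓧]
  [MulAction G 𝓧] [ProperSMul G 𝓧] {Ω : Type*} [MeasurableSpace Ω] {P : Measure Ω}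
  [IsProbabilityMeasure P] {X : Ω → 𝓧} {g : Ω → G} {ε : Ω → Set.Ioo (0 : ℝ) 1}

theorem map_eq_noiseLaw (hX : Measurable X) (hg : Measurable g) (hε : Measurable ε)
    (hcond : HasCondLaw g X (unifStabilizer G) P) (hlaw : HasLaw ε unifUnitInterval P)
    (hind : IndepFun ε (fun ω => (X ω, g ω)) P) :
    P.map (fun ω => ((X ω, g ω), ε ω)) = noiseLaw G (P.map X) := by
  obtain ⟨κ, hκ, hκd, hae⟩ := hcond
  have h1 := (indepFun_iff_map_prod_eq_prod_map_map (by fun_prop) (by fun_prop)).mp hind.symm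
  have h2 : κ =ᵐ[P.map X] unifStabilizerKernel G 𝓧 := hae
  rw [h1, hlaw.map_eq, HasLaw.map_eq hκd, Measure.compProd_congr h2, noiseLaw]

theorem noise_properties_of_map_eq {μ : Measure 𝓧} [IsProbabilityMeasure μ] (hX : Measurable X)
    (hg : Measurable g) (hε : Measurable ε)
    (h : P.map (fun ω => ((X ω, g ω), ε ω)) = noiseLaw G μ) :
    HasCondLaw g X (unifStabilizer G) P ∧ HasLaw ε unifUnitInterval P ∧
      IndepFun ε (fun ω => (X ω, g ω)) P := by
  have hXg : P.map (fun ω => (X ω, g ω)) = μ ⊗ₘ unifStabilizerKernel G 𝓧 := by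
    have := congrArg (Measure.map Prod.fst) h
    rwa [Measure.map_map (by fun_prop) (by fun_prop), noiseLaw, Measure.map_fst_prod, measure_univ,
      one_smul] at this
  have hεl : P.map ε = unifUnitInterval := by
    have := congrArg (Measure.map Prod.snd) h
    rwa [Measure.map_map (by fun_prop) (by fun_prop), noiseLaw, Measure.map_snd_prod, measure_univ,
      one_smul] at this
  have hXl : P.map X = μ := by
    have := congrArg (Measure.map Prod.fst) hXg
    rwa [Measure.map_map (by fun_prop) (by fun_prop), ← Measure.fst, Measure.fst_compProd] at this
  refine ⟨⟨unifStabilizerKernel G 𝓧, inferInstance, ⟨by fun_prop, by rw [hXg, hXl]⟩,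
    Filter.Eventually.of_forall fun _ => rfl⟩, ⟨by fun_prop, hεl⟩, ?_⟩
  refine IndepFun.symm ((indepFun_iff_map_prod_eq_prod_map_map (by fun_prop) (by fun_prop)).mpr ?_)
  rw [h, hXg, hεl, noiseLaw]

end Noise

/-! ### The equivalence -/

theorem mainTheorem3
    {G : Type*} [Group G] [TopologicalSpace G] [IsTopologicalGroup G] [LocallyCompactSpace G]
    [SecondCountableTopology G] [T2Space G] [MeasurableSpace G] [BorelSpace G]
    {𝓧 : Type*} [TopologicalSpace 𝓧] [PolishSpace 𝓧] [MeasurableSpace 𝓧] [BorelSpace 𝓧]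
    [MulAction G 𝓧] [ProperSMul G 𝓧]
    {𝓨 : Type*} [MeasurableSpace 𝓨] [StandardBorelSpace 𝓨]
    [MulAction G 𝓨] [MeasurableSMul₂ G 𝓨]
    {Ω : Type u} [MeasurableSpace Ω] (P : Measure Ω) [IsProbabilityMeasure P]
    (X : Ω → 𝓧) (Y : Ω → 𝓨) (hX : Measurable X) (hY : Measurable Y) :
    IsEquivariantCondDistrib G Y X P ↔
      ∃ f : 𝓧 × Set.Ioo (0 : ℝ) 1 → 𝓨, Measurable f ∧
        (∀ e : Set.Ioo (0 : ℝ) 1, IsRelaxedEquivariant G (fun x => f (x, e))) ∧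
        -- an extension `π : Ω' → Ω` of the probability space, carrying `g_X` and `ε`
        ∃ (Ω' : Type u) (_ : MeasurableSpace Ω') (P' : Measure Ω') (π : Ω' → Ω)
          (gX : Ω' → G) (ε : Ω' → Set.Ioo (0 : ℝ) 1),
          IsProbabilityMeasure P' ∧ MeasurePreserving π P' P ∧ Measurable gX ∧ Measurable ε ∧
          HasCondLaw gX (X ∘ π) (unifStabilizer G) P' ∧
          HasLaw ε unifUnitInterval P' ∧
          IndepFun ε (fun ω => (X (π ω), gX ω)) P' ∧
          ∀ᵐ ω ∂P', Y (π ω) = gX ω • f (X (π ω), ε ω) := by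
  constructor
  · rintro ⟨κ, hκ, hκd, hκe⟩
    have : Nonempty Ω := nonempty_of_isProbabilityMeasure P
    have : Nonempty 𝓨 := this.map Y
    have : PolishSpace G := polishSpace_of_locallyCompact_group G
    have : Nonempty (Set.Ioo (0 : ℝ) 1) := ⟨1 / 2, by norm_num, by norm_num⟩
    have : StandardBorelSpace (Set.Ioo (0 : ℝ) 1) := measurableSet_Ioo.standardBorel
    have : IsProbabilityMeasure (P.map X) := Measure.isProbabilityMeasure_map hX.aemeasurable
    obtain ⟨f, hf, hre, hfκ⟩ := exists_noiseKernel_eq κ hκe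
    -- the joint law of `((X, Y), (g, ε))`
    let T : (𝓧 × G) × Set.Ioo (0 : ℝ) 1 → (𝓧 × 𝓨) × G × Set.Ioo (0 : ℝ) 1 :=
      fun q => ((q.1.1, q.1.2 • f (q.1.1, q.2)), (q.1.2, q.2))
    have hT : Measurable T := by fun_prop
    let M : Measure ((𝓧 × 𝓨) × G × Set.Ioo (0 : ℝ) 1) := (noiseLaw G (P.map X)).map T
    have : IsProbabilityMeasure M := Measure.isProbabilityMeasure_map hT.aemeasurable
    have hMfst : M.fst = P.map fun ω => (X ω, Y ω) := by
      rw [HasLaw.map_eq hκd, ← hfκ, ← map_noiseLaw hf, Measure.fst,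
        Measure.map_map (by fun_prop) hT]
      rfl
    -- Since `M.fst` is the law of `(X, Y)`, sampling `M.condKernel` at `(X, Y)` with an independent
    -- uniform variable gives joint law `M`.
    obtain ⟨ψ, hψ, hψM⟩ := M.condKernel.exists_measurable_map_eq_unitInterval
    let R : Ω × unitInterval → G × Set.Ioo (0 : ℝ) 1 := fun ω => ψ (X ω.1, Y ω.1) ω.2
    have hR : Measurable R :=
      hψ.comp (by fun_prop : Measurable fun ω : Ω × unitInterval => ((X ω.1, Y ω.1), ω.2))
    let P' : Measure (Ω × unitInterval) := P.prod volume
    have hlaw : P'.map (fun ω => ((X ω.1, Y ω.1), R ω)) = M := by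
      have := map_prod_eq_map_compProd (P := P) (Z := fun ω => (X ω, Y ω)) (by fun_prop) hψ hψM
      rw [← hMfst, M.disintegrate] at this
      exact this
    have hae : ∀ᵐ ω ∂P', Y ω.1 = (R ω).1 • f (X ω.1, (R ω).2) := by
      have hms : MeasurableSet {q : (𝓧 × 𝓨) × G × Set.Ioo (0 : ℝ) 1 | q.1.2 = q.2.1 • f (q.1.1, q.2.2)} :=
        measurableSet_eq_fun (by fun_prop) (by fun_prop)
      have : ∀ᵐ q ∂M, q.1.2 = q.2.1 • f (q.1.1, q.2.2) :=
        (ae_map_iff hT.aemeasurable hms).mpr (Filter.Eventually.of_forall fun q => rfl)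
      rw [← hlaw, ae_map_iff (by fun_prop) hms] at this
      exact this
    have hnoise : P'.map (fun ω => ((X ω.1, (R ω).1), (R ω).2)) = noiseLaw G (P.map X) := by
      -- Forgetting the `𝓨` coordinate is a left inverse of `T`, which recovers `noiseLaw`.
      have := congrArg (Measure.map fun q : (𝓧 × 𝓨) × G × Set.Ioo (0 : ℝ) 1 => ((q.1.1, q.2.1), q.2.2)) hlaw
      rw [Measure.map_map (by fun_prop) (by fun_prop), Measure.map_map (by fun_prop) hT] at this
      exact this.trans Measure.map_id
    obtain ⟨h1, h2, h3⟩ := noise_properties_of_map_eq (hX.comp measurable_fst) hR.fst hR.snd hnoise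
    exact ⟨f, hf, hre, Ω × unitInterval, inferInstance, P', Prod.fst, fun ω => (R ω).1,
      fun ω => (R ω).2, inferInstance, measurePreserving_fst, hR.fst, hR.snd, h1, h2, h3, hae⟩
  · rintro ⟨f, hf, hre, Ω', _, P', π, g, ε, hP', hπ, hg, hε, hcond, hlaw, hind, hae⟩
    have hπm := hπ.measurable
    have h := map_eq_noiseLaw (hX.comp hπm) hg hε hcond hlaw hind
    refine ⟨noiseKernel (G := G) f, isMarkovKernel_noiseKernel hf, ⟨by fun_prop, ?_⟩,
      noiseKernel_smul hf hre⟩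
    have hXl : P'.map (X ∘ π) = P.map X := by rw [← Measure.map_map hX hπm, hπ.map_eq]
    rw [← map_noiseLaw hf, ← hXl, ← h, Measure.map_map (by fun_prop) (by fun_prop), ← hπ.map_eq,
      Measure.map_map (by fun_prop) hπm]
    refine Measure.map_congr ?_
    filter_upwards [hae] with ω hω
    simp [hω]
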